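/- Let $g\ge 1$ be an integer. **The matrices.** For an integer $k\ge 0$ and a nonzero element $m$ of a field, let $P_k(m)$ be the $(2k+2)\times(2k+2)$ matrix and $Q_k$ the $(2k+2)\times(2k+4)$ matrix $$P_k(m)=\begin{bmatrix}V_k^+&0\\0&V_k^-\\ [\,0\ \ I_k\,]&-m\,[\,0\ \ I_k\,]\end{bmatrix},\qquad Q_k=\begin{bmatrix}W_k^+&0\\0&W_k^-\\0&0\end{bmatrix},$$ where $[\,0\ \ I_k\,]$ is the $k\times(k+1)$ matrix whose first column is zero, followed by the identity matrix. Here $V_k^{+}$ and $W_k^{+}$ have $\lfloor (k+3)/2\rfloor$ rows, $V_k^-$ and $W_k^-$ have $\lfloor (k+2)/2\rfloor$ rows, $V_k^\pm$ have $k+1$ columns and $W_k^\pm$ have $k+2$ columns. With rows $i$ and columns $j$ numbered from $0$, the $(i,j)$ entry of $V_k^+$ and of $W_k^+$ is $1$ if $j=i$ or $i+j=k+1$, and $0$ otherwise; the $(i,j)$ entry of $V_k^-$ and of $W_k^-$ is $1$ if $j=i$, $-1$ if $i+j=k+1$, and $0$ otherwise. (So $P_0$ is the $2\times 2$ identity matrix.)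 **The linear system.** Let $c_0,\dots,c_g$ and $\log q$ be indeterminates. Let $v_g(0)$ be the column vector of length $4g+2$ over $\mathbb{Q}(c_0,\dots,c_g,\log q)$ whose first $2g+1$ entries are $c_0,c_1,\dots,c_{g-1},c_g,c_{g-1},\dots,c_1,c_0$ and whose last $2g+1$ entries are $c_0\,g\log q,\ c_1(g-1)\log q,\ \dots,\ c_{g-1}\log q,\ 0,\ -c_{g-1}\log q,\ \dots,\ -c_1(g-1)\log q,\ -c_0\,g\log q$. For $1\le n\le 2g$ define successively, writing $v[j]$ for the $j$-th component of $v$ (numbered from $1$), $$m_{2g-n}=\frac{v_g(n-1)[1]+v_g(n-1)[2g-n+2]}{v_g(n-1)[2g-n+3]-v_g(n-1)[4g-2n+4]},\qquad v_g(n)=P_{2g-n}(m_{2g-n})^{-1}\,Q_{2g-n}\,v_g(n-1),$$ where $v_g(n)$ has length $4g-2n+2$. Thus each $m_{2g-n}$ is a rational function in $\mathbb{Q}(c_0,\dots,c_g,\log q)$. For real numbers $c_0,\dots,c_g$ and $q>1$, let $m_{2g-n}(\underline c\,;\log q)$ and $m_{2g-n}(\underline c\,;\log q)^{-1}$ denote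 the values of the rational functions $m_{2g-n}$ and $m_{2g-n}^{-1}$ at the point $(c_0,\dots,c_g,\log q)$. An inequality between such a value and $0$ includes the assertion that the rational function is defined at that point, that is, can be written as a quotient of two polynomials whose denominator does not vanish there. **Theorem.** Let $g\ge 1$ and $q>1$, let $c_0,\dots,c_g$ be real numbers with $c_0\neq 0$, and let $$P_g(x)=\sum_{k=0}^{g-1}c_k\,(x^{2g-k}+x^k)+c_g x^g .$$ Then all complex zeros of $P_g(x)$ lie on the unit circle $|x|=1$ and are simple if and only if $$m_{2g-n}(\underline c\,;\log q)>0\quad\text{and}\quad m_{2g-n}(\underline c\,;\log q)^{-1}>0\qquad\text{for every }1\le n\le 2g .$$ -/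

import Mathlib

open Polynomial

noncomputable section

namespace SelfReciprocal

/-! ### The polynomial -/

/-- The self-reciprocal polynomial
`P_g(x) = ∑_{k=0}^{g-1} c_k (x^{2g-k} + x^k) + c_g x^g`. -/
def selfRecPoly (g : ℕ) (c : Fin (g + 1) → ℝ) : ℝ[X] :=
  (∑ k : Fin g, C (c k.castSucc) * (X ^ (2 * g - (k : ℕ)) + X ^ (k : ℕ)))
    + C (c (Fin.last g)) * X ^ g

/-! ### The linear system, over an arbitrary field

All indices start at `0`, so the component called `v[j]` in one-based notation is `v (j - 1)`. -/

section System

variable {F : Type*} [Field F]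

/-- The entries of `V_k^+` (`(k+3)/2` rows, rounded down, columns `0 ≤ j ≤ k`) and of `W_k^+`
(same rows, columns `0 ≤ j ≤ k + 1`): `1` on the diagonal and `1` on the antidiagonal
`i + j = k + 1`. For odd `k` both meet in the last row, where the entry is still `1`. -/
def plusEntry (k i j : ℕ) : F :=
  if j = i ∨ i + j = k + 1 then 1 else 0

/-- The entries of `V_k^-` (`(k+2)/2` rows, rounded down, columns `0 ≤ j ≤ k`) and of `W_k^-`
(same rows, columns `0 ≤ j ≤ k + 1`): `1` on the diagonal and `-1` on the antidiagonal
`i + j = k + 1`. -/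
def minusEntry (k i j : ℕ) : F :=
  if j = i then 1 else if i + j = k + 1 then -1 else 0

/-- The square matrix `P_k(m)` of size `2k + 2`, with the row blocks
`[V_k^+ | 0]`, `[0 | V_k^-]`, `[0 I_k | -m · 0 I_k]` having `(k+3)/2`, `(k+2)/2` (rounded down) and
`k` rows, and two column blocks having `k + 1` columns each.
For `k = 0` this is the `2 × 2` identity matrix. -/
def matP (k : ℕ) (m : F) : Matrix (Fin (2 * k + 2)) (Fin (2 * k + 2)) F :=
  Matrix.of fun r s =>
    if (r : ℕ) < (k + 3) / 2 then
      if (s : ℕ) < k + 1 then plusEntry k r s else 0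
    else if (r : ℕ) < k + 2 then
      if (s : ℕ) < k + 1 then 0 else minusEntry k (r - (k + 3) / 2) (s - (k + 1))
    else
      if (s : ℕ) = (r - (k + 2)) + 1 then 1
      else if (s : ℕ) = (k + 1) + ((r - (k + 2)) + 1) then -m
      else 0

/-- The `(2k + 2) × (2k + 4)` matrix `Q_k`, with the row blocks
`[W_k^+ | 0]`, `[0 | W_k^-]`, `[0 | 0]` having `(k+3)/2`, `(k+2)/2` (rounded down) and `k` rows,
and two column blocks having `k + 2` columns each. -/
def matQ (k : ℕ) : Matrix (Fin (2 * k + 2)) (Fin (2 * k + 4)) F :=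
  Matrix.of fun r s =>
    if (r : ℕ) < (k + 3) / 2 then
      if (s : ℕ) < k + 2 then plusEntry k r s else 0
    else if (r : ℕ) < k + 2 then
      if (s : ℕ) < k + 2 then 0 else minusEntry k (r - (k + 3) / 2) (s - (k + 2))
    else 0

/-- `m_k = (w[1] + w[k+2]) / (w[k+3] - w[2k+4])` (one-based), for a vector `w` of length
`2k + 4`. -/
def stepM (k : ℕ) (w : Fin (2 * k + 4) → F) : F :=
  (w ⟨0, by omega⟩ + w ⟨k + 1, by omega⟩) / (w ⟨k + 2, by omega⟩ - w ⟨2 * k + 3, by omega⟩)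

/-- One step of the linear system: `w ↦ P_k(m_k)⁻¹ Q_k w`. -/
def stepV (k : ℕ) (w : Fin (2 * k + 4) → F) : Fin (2 * k + 2) → F :=
  Matrix.mulVec (matP k (stepM k w))⁻¹ (Matrix.mulVec (matQ k) w)

/-- The vectors `v_g(n)`, `0 ≤ n ≤ 2g`, of length `4g - 2n + 2 = 2(2g - n) + 2`, with initial
vector `v_g(0) = v₀`. -/
def sysV (g : ℕ) (v₀ : Fin (2 * (2 * g) + 2) → F) :
    (n : ℕ) → n ≤ 2 * g → Fin (2 * (2 * g - n) + 2) → F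
  | 0, _ => v₀
  | n + 1, h =>
      stepV (2 * g - (n + 1)) fun j => sysV g v₀ n (by omega) (Fin.cast (by omega) j)

/-- The quantities `m_{2g-n}`, `1 ≤ n ≤ 2g`, computed from `v_g(n-1)`. -/
def sysM (g : ℕ) (v₀ : Fin (2 * (2 * g) + 2) → F) (n : ℕ) (h₁ : 1 ≤ n) (h₂ : n ≤ 2 * g) : F :=
  stepM (2 * g - n) fun j => sysV g v₀ (n - 1) (by omega) (Fin.cast (by omega) j)

/-- The initial vector: first `c_0, …, c_{g-1}, c_g, c_{g-1}, …, c_0`, then the same entries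
multiplied by `g ℓ, (g-1) ℓ, …, ℓ, 0, -ℓ, …, -g ℓ`, where `ℓ` stands for `log q`
(so that `(g - j) ℓ = log (q ^ (g - j))`). -/
def initV (g : ℕ) (c : Fin (g + 1) → F) (l : F) (i : Fin (2 * (2 * g) + 2)) : F :=
  if (i : ℕ) < 2 * g + 1 then
    c ⟨min (i : ℕ) (2 * g - i), by omega⟩
  else
    c ⟨min ((i : ℕ) - (2 * g + 1)) (2 * g - ((i : ℕ) - (2 * g + 1))), by omega⟩
      * (((g : F) - (((i : ℕ) - (2 * g + 1) : ℕ) : F)) * l)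

end System

/-! ### Rational functions of `c_0, …, c_g, log q` and their values -/

/-- The field `ℚ(c_0, …, c_g, log q)` of rational functions in `g + 2` indeterminates: `some k`
is the index of `c_k`, and `none` is the index of `log q`. -/
abbrev CoeffField (g : ℕ) : Type :=
  FractionRing (MvPolynomial (Option (Fin (g + 1))) ℚ)

/-- The indeterminate with index `i`, as an element of the rational function field. -/
def indet (g : ℕ) (i : Option (Fin (g + 1))) : CoeffField g :=
  algebraMap (MvPolynomial (Option (Fin (g + 1))) ℚ) (CoeffField g) (MvPolynomial.X i)

/-- The rational function `m_{2g-n}(c ; log q) ∈ ℚ(c_0, …, c_g, log q)`. -/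
def ratM (g n : ℕ) (h₁ : 1 ≤ n) (h₂ : n ≤ 2 * g) : CoeffField g :=
  sysM g (initV g (fun k => indet g (some k)) (indet g none)) n h₁ h₂

/-- The point `(c_0, …, c_g, log q)` of `ℝ^{g+2}`. -/
def evalPoint (g : ℕ) (c : Fin (g + 1) → ℝ) (q : ℝ) : Option (Fin (g + 1)) → ℝ
  | none => Real.log q
  | some k => c k

/-- The rational function `f` is defined (finite) at the real point `x` and takes the value `y`
there: it is a quotient of polynomials whose denominator does not vanish at `x`, and `y` is the
quotient of their values. -/
def HasValueAt {g : ℕ} (f : CoeffField g) (x : Option (Fin (g + 1)) → ℝ) (y : ℝ) : Prop :=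
  ∃ a b : MvPolynomial (Option (Fin (g + 1))) ℚ,
    MvPolynomial.aeval x b ≠ 0 ∧
    f = algebraMap _ (CoeffField g) a / algebraMap _ (CoeffField g) b ∧
    y = MvPolynomial.aeval x a / MvPolynomial.aeval x b

/-- A rational function has at most one value at a given point. -/
theorem HasValueAt.unique {g : ℕ} {f : CoeffField g} {x : Option (Fin (g + 1)) → ℝ} {y y' : ℝ}
    (h : HasValueAt f x y) (h' : HasValueAt f x y') : y = y' := by
  obtain ⟨a, b, hb, hf, rfl⟩ := h
  obtain ⟨a', b', hb', hf', rfl⟩ := h'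
  have inj := IsFractionRing.injective (MvPolynomial (Option (Fin (g + 1))) ℚ) (CoeffField g)
  have hne : ∀ d : MvPolynomial (Option (Fin (g + 1))) ℚ, MvPolynomial.aeval x d ≠ 0 →
      algebraMap _ (CoeffField g) d ≠ 0 := by
    intro d hd h0
    apply hd
    have : d = 0 := inj (by rw [h0, map_zero])
    rw [this, map_zero]
  have e := hf.symm.trans hf'
  rw [div_eq_div_iff (hne b hb) (hne b' hb'), ← map_mul, ← map_mul] at e
  have e' := congrArg (MvPolynomial.aeval x) (inj e)
  rw [map_mul, map_mul] at e'
  rw [div_eq_div_iff hb hb', e']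

end SelfReciprocal

end

open Polynomial

noncomputable section

namespace SelfReciprocal

/-! ### One step of the linear system, solved in closed form. -/

section LinearAlgebra

variable {F : Type*} [Field F]

/-! The linear system is the Schur–Cohn algorithm in disguise. By Cohn's criterion
(`zeroFree_reversedDerivative_iff`), the self-reciprocal polynomial $A$ of degree $2g$ has only
simple zeros, all on the unit circle, exactly when $2gA - xA'$ has no zero in the closed unit disc.

Solving one step explicitly (`stepV_joinHalves`) shows that the first step turns the two halves into
multiples of the coefficients of $2gA - xA'$. From then on the halves are the coefficients of some
$f$ and of $f/\mu$ with $\mu > 0$. With $k+1$ the formal degree of $f$ and $f^*$ its reversal, a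
further step gives $m = \mu r$ with $r = (f_0 + f_{k+1})/(f_0 - f_{k+1})$, and replaces $f$ by
$\frac{1+r}{2} f + \frac{1-r}{2} f^*$, whose formal degree is lower by one.

Positivity of $r$ means $|f_{k+1}| < |f_0|$. This is necessary for $f$ to be zero-free
(`ZeroFree.abs_coeff_lt`), and when it holds the step preserves zero-freeness in both directions
(`zeroFree_schurStep_iff`). After $2g$ steps a nonzero constant is left, which is zero-free. The
values of the rational functions are carried along the steps by `HasHalves` and `StepInvariant`. -/

theorem sum_fin_halves (n N : ℕ) (hN : N = n + n) (e a b : ℕ → F) :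
    ∑ s : Fin N, e s * (if (s : ℕ) < n then a s else b (s - n)) =
      ∑ s ∈ Finset.range n, e s * a s + ∑ s ∈ Finset.range n, e (n + s) * b s := by
  rw [Fin.sum_univ_eq_sum_range (fun s => e s * (if s < n then a s else b (s - n))) N, hN,
    Finset.sum_range_add]
  congr 1
  · exact Finset.sum_congr rfl fun s hs => by rw [if_pos (Finset.mem_range.mp hs)]
  · exact Finset.sum_congr rfl fun s _ => by simp

/-- In the exceptional case the diagonal and the antidiagonal share one entry, which is counted
once. -/
theorem sum_plusEntry (k i : ℕ) (hi : i < (k + 3) / 2) (a : ℕ → F) :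
    ∑ s ∈ Finset.range (k + 2), plusEntry k i s * a s =
      if 2 * i = k + 1 then a i else a i + a (k + 1 - i) := by
  split_ifs with h
  · rw [Finset.sum_eq_single i]
    · simp [plusEntry]
    · intro s _ hs
      rw [plusEntry, if_neg (by omega), zero_mul]
    · intro hs
      simp at hs
      omega
  · rw [Finset.sum_eq_add i (k + 1 - i) (by omega)]
    · rw [plusEntry, if_pos (Or.inl rfl), plusEntry, if_pos (Or.inr (by omega)), one_mul, one_mul]
    · intro s _ hs
      rw [plusEntry, if_neg (by omega), zero_mul]
    · intro hs
      simp at hs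
      omega
    · intro hs
      simp at hs
      omega

theorem sum_minusEntry (k i : ℕ) (hi : i < (k + 2) / 2) (b : ℕ → F) :
    ∑ s ∈ Finset.range (k + 2), minusEntry k i s * b s = b i - b (k + 1 - i) := by
  rw [Finset.sum_eq_add i (k + 1 - i) (by omega)]
  · rw [minusEntry, if_pos rfl, minusEntry, if_neg (by omega), if_pos (by omega), one_mul,
      neg_one_mul, sub_eq_add_neg]
  · intro s _ hs
    rw [minusEntry, if_neg (by omega), if_neg (by omega), zero_mul]
  · intro hs
    simp at hs
    omega
  · intro hs
    simp at hs
    omega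

/-- The two halves `a`, `b` of length `n`, joined to a vector of length `N = 2n`. -/
def joinHalves (n N : ℕ) (a b : ℕ → F) (s : Fin N) : F :=
  if (s : ℕ) < n then a s else b (s - n)

theorem exists_eq_joinHalves (n : ℕ) (N : ℕ) (hN : N = n + n) (u : Fin N → F) :
    ∃ a b : ℕ → F, a n = 0 ∧ b n = 0 ∧ u = joinHalves n N a b := by
  -- Padding by zero at index `n` lets the shorter rows of `V` be summed over the same range as
  -- those of `W`.
  refine ⟨fun i => if h : i < n then u ⟨i, by omega⟩ else 0,
    fun i => if h : i < n then u ⟨n + i, by omega⟩ else 0, by simp, by simp, ?_⟩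
  funext s
  have := s.2
  unfold joinHalves
  by_cases hs : (s : ℕ) < n
  · simp [hs]
  · have h1 : (s : ℕ) - n < n := by omega
    rw [if_neg hs]
    simp only [h1, dite_true]
    congr 1
    ext
    simp
    omega

theorem matQ_mulVec_plus (k : ℕ) (a b : ℕ → F) (r : Fin (2 * k + 2))
    (hr : (r : ℕ) < (k + 3) / 2) :
    ((matQ k).mulVec (joinHalves (k + 2) (2 * k + 4) a b)) r =
      if 2 * (r : ℕ) = k + 1 then a r else a r + a (k + 1 - r) := by
  have := sum_fin_halves (k + 2) (2 * k + 4) (by omega)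
    (fun s => if s < k + 2 then plusEntry k r s else (0 : F)) a b
  simp only [Matrix.mulVec, dotProduct, matQ, Matrix.of_apply, hr, if_true, joinHalves]
  rw [this, ← sum_plusEntry k r hr a]
  simp only [add_lt_iff_neg_left, not_lt_zero, if_false, zero_mul, Finset.sum_const_zero, add_zero]
  exact Finset.sum_congr rfl fun s hs => by rw [if_pos (Finset.mem_range.mp hs)]

theorem matQ_mulVec_minus (k : ℕ) (a b : ℕ → F) (r : Fin (2 * k + 2))
    (hr : ¬ (r : ℕ) < (k + 3) / 2) (hr' : (r : ℕ) < k + 2) :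
    ((matQ k).mulVec (joinHalves (k + 2) (2 * k + 4) a b)) r =
      b (r - (k + 3) / 2) - b (k + 1 - (r - (k + 3) / 2)) := by
  have := sum_fin_halves (k + 2) (2 * k + 4) (by omega)
    (fun s => if s < k + 2 then 0 else (minusEntry k (r - (k + 3) / 2) (s - (k + 2)) : F)) a b
  simp only [Matrix.mulVec, dotProduct, matQ, Matrix.of_apply, hr, hr', if_true, if_false,
    joinHalves]
  rw [this, ← sum_minusEntry k (r - (k + 3) / 2) (by omega) b]
  simp only [add_lt_iff_neg_left, not_lt_zero, if_false, Nat.add_sub_cancel_left]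
  rw [Finset.sum_eq_zero, zero_add]
  intro s hs
  rw [if_pos (Finset.mem_range.mp hs), zero_mul]

theorem matQ_mulVec_zero (k : ℕ) (w : Fin (2 * k + 4) → F) (r : Fin (2 * k + 2))
    (hr : ¬ (r : ℕ) < (k + 3) / 2) (hr' : ¬ (r : ℕ) < k + 2) :
    ((matQ k).mulVec w) r = 0 := by
  simp [Matrix.mulVec, dotProduct, matQ, hr, hr']

theorem matP_mulVec_plus (k : ℕ) (m : F) (a b : ℕ → F) (ha : a (k + 1) = 0)
    (r : Fin (2 * k + 2)) (hr : (r : ℕ) < (k + 3) / 2) :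
    ((matP k m).mulVec (joinHalves (k + 1) (2 * k + 2) a b)) r =
      if 2 * (r : ℕ) = k + 1 then a r else a r + a (k + 1 - r) := by
  have := sum_fin_halves (k + 1) (2 * k + 2) (by omega)
    (fun s => if s < k + 1 then plusEntry k r s else (0 : F)) a b
  simp only [Matrix.mulVec, dotProduct, matP, Matrix.of_apply, hr, if_true, joinHalves]
  rw [this, ← sum_plusEntry k r hr a, Finset.sum_range_succ _ (k + 1), ha, mul_zero, add_zero]
  simp only [add_lt_iff_neg_left, not_lt_zero, if_false, zero_mul, Finset.sum_const_zero, add_zero]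
  exact Finset.sum_congr rfl fun s hs => by rw [if_pos (Finset.mem_range.mp hs)]

theorem matP_mulVec_minus (k : ℕ) (m : F) (a b : ℕ → F) (hb : b (k + 1) = 0)
    (r : Fin (2 * k + 2)) (hr : ¬ (r : ℕ) < (k + 3) / 2) (hr' : (r : ℕ) < k + 2) :
    ((matP k m).mulVec (joinHalves (k + 1) (2 * k + 2) a b)) r =
      b (r - (k + 3) / 2) - b (k + 1 - (r - (k + 3) / 2)) := by
  have := sum_fin_halves (k + 1) (2 * k + 2) (by omega)
    (fun s => if s < k + 1 then 0 else (minusEntry k (r - (k + 3) / 2) (s - (k + 1)) : F)) a b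
  simp only [Matrix.mulVec, dotProduct, matP, Matrix.of_apply, hr, hr', if_true, if_false,
    joinHalves]
  rw [this, ← sum_minusEntry k (r - (k + 3) / 2) (by omega) b, Finset.sum_range_succ _ (k + 1),
    hb, mul_zero, add_zero]
  simp only [add_lt_iff_neg_left, not_lt_zero, if_false, Nat.add_sub_cancel_left]
  rw [Finset.sum_eq_zero, zero_add]
  intro s hs
  rw [if_pos (Finset.mem_range.mp hs), zero_mul]

theorem matP_mulVec_last (k : ℕ) (m : F) (a b : ℕ → F)
    (r : Fin (2 * k + 2)) (hr' : ¬ (r : ℕ) < k + 2) :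
    ((matP k m).mulVec (joinHalves (k + 1) (2 * k + 2) a b)) r =
      a (r - (k + 1)) - m * b (r - (k + 1)) := by
  have hr : ¬ (r : ℕ) < (k + 3) / 2 := by omega
  have h2 := r.2
  have := sum_fin_halves (k + 1) (2 * k + 2) (by omega)
    (fun s => if s = (r - (k + 2)) + 1 then (1 : F)
      else if s = (k + 1) + ((r - (k + 2)) + 1) then -m else 0) a b
  simp only [Matrix.mulVec, dotProduct, matP, Matrix.of_apply, hr, hr', if_false, joinHalves]
  rw [this, Finset.sum_eq_single ((r : ℕ) - (k + 1)), Finset.sum_eq_single ((r : ℕ) - (k + 1)),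
    if_pos (by omega), if_neg (by omega), if_pos (by omega)]
  · ring
  · intro s hs hne
    rw [if_neg (by simp at hs; omega), if_neg (by omega), zero_mul]
  · intro h
    simp at h
    omega
  · intro s hs hne
    rw [if_neg (by omega), if_neg (by simp at hs; omega), zero_mul]
  · intro h
    simp at h
    omega

/-- For a kernel vector with halves `a`, `b`, padded by zero at `k + 1`, the first two row blocks
make `a` antisymmetric and `b` symmetric under `i ↦ k + 1 - i`. The last block gives `a = m b` at
the interior indices, so `2 m b` vanishes there. Index `0` is paired with the padding. -/
theorem isUnit_matP (h2 : (2 : F) ≠ 0) (k : ℕ) {m : F} (hm : m ≠ 0) : IsUnit (matP k m) := by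
  rw [← Matrix.mulVec_injective_iff_isUnit]
  rw [← Matrix.coe_mulVecLin, injective_iff_map_eq_zero]
  intro u hu
  rw [Matrix.coe_mulVecLin] at hu
  obtain ⟨a, b, ha, hb, rfl⟩ := exists_eq_joinHalves (k + 1) (2 * k + 2) (by omega) u
  have hA₀ : ∀ i, 2 * i ≤ k + 1 → a i + a (k + 1 - i) = 0 := by
    intro i hi
    have h := matP_mulVec_plus k m a b ha ⟨i, by omega⟩ (by simp; omega)
    rw [hu] at h
    simp only [Pi.zero_apply] at h
    split_ifs at h with h'
    · rw [show k + 1 - i = i by omega, ← h, add_zero]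
    · exact h.symm
  have hB₀ : ∀ i, 2 * i ≤ k → b i = b (k + 1 - i) := by
    intro i hi
    have h := matP_mulVec_minus k m a b hb ⟨(k + 3) / 2 + i, by omega⟩ (by simp)
      (by simp; omega)
    rw [hu] at h
    simp only [Pi.zero_apply, Nat.add_sub_cancel_left] at h
    exact sub_eq_zero.mp h.symm
  have hA : ∀ i ≤ k + 1, a i + a (k + 1 - i) = 0 := by
    intro i hi
    rcases le_total (2 * i) (k + 1) with h | h
    · exact hA₀ i h
    · have := hA₀ (k + 1 - i) (by omega)
      rwa [show k + 1 - (k + 1 - i) = i by omega, add_comm] at this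
  have hB : ∀ i ≤ k + 1, b i = b (k + 1 - i) := by
    intro i hi
    rcases lt_trichotomy (2 * i) (k + 1) with h | h | h
    · exact hB₀ i (by omega)
    · rw [show k + 1 - i = i by omega]
    · have := hB₀ (k + 1 - i) (by omega)
      rw [show k + 1 - (k + 1 - i) = i by omega] at this
      exact this.symm
  have hab : ∀ i, 1 ≤ i → i ≤ k → a i = m * b i := by
    intro i h1 hi
    have h := matP_mulVec_last k m a b ⟨k + 1 + i, by omega⟩ (by simp; omega)
    rw [hu] at h
    simp only [Pi.zero_apply, Nat.add_sub_cancel_left] at h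
    exact sub_eq_zero.mp h.symm
  have hzero : ∀ i ≤ k, a i = 0 ∧ b i = 0 := by
    intro i hi
    rcases Nat.eq_zero_or_pos i with rfl | h1
    · have e1 := hA 0 (by omega)
      have e2 := hB 0 (by omega)
      simp only [Nat.sub_zero, ha, hb, add_zero] at e1 e2
      exact ⟨e1, e2⟩
    · have e1 := hA i (by omega)
      rw [hab i h1 hi, hab (k + 1 - i) (by omega) (by omega), ← hB i (by omega)] at e1
      have e2 : 2 * m * b i = 0 := by linear_combination e1
      have hbi : b i = 0 := (mul_eq_zero.mp e2).resolve_left (mul_ne_zero h2 hm)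
      exact ⟨by rw [hab i h1 hi, hbi, mul_zero], hbi⟩
  funext s
  have := s.2
  unfold joinHalves
  split_ifs with h
  · exact (hzero _ (by omega)).1
  · exact (hzero _ (by omega)).2

theorem stepM_joinHalves (k : ℕ) (a b : ℕ → F) :
    stepM k (joinHalves (k + 2) (2 * k + 4) a b) = (a 0 + a (k + 1)) / (b 0 - b (k + 1)) := by
  simp only [stepM, joinHalves]
  rw [if_pos (by omega), if_pos (by omega), if_neg (by omega), if_neg (by omega),
    Nat.sub_self, show 2 * k + 3 - (k + 2) = k + 1 by omega]

/-- The solution of the linear system of one step. -/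
theorem stepV_joinHalves (h2 : (2 : F) ≠ 0) (k : ℕ) (a b : ℕ → F) (m : F) (hm : m ≠ 0)
    (hstep : stepM k (joinHalves (k + 2) (2 * k + 4) a b) = m) :
    stepV k (joinHalves (k + 2) (2 * k + 4) a b) = joinHalves (k + 1) (2 * k + 2)
      (fun i => ((a i + a (k + 1 - i)) + m * (b i - b (k + 1 - i))) / 2)
      (fun i => ((a i + a (k + 1 - i)) + m * (b i - b (k + 1 - i))) / 2 / m) := by
  have hu := isUnit_matP h2 k hm
  have hdet := (Matrix.isUnit_iff_isUnit_det _).mp hu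
  have h0 : a 0 + a (k + 1) = m * (b 0 - b (k + 1)) := by
    rw [stepM_joinHalves] at hstep
    -- A vanishing denominator would make the quotient `0` by convention, against `m ≠ 0`.
    have hd : b 0 - b (k + 1) ≠ 0 := by
      intro h
      rw [h, div_zero] at hstep
      exact hm hstep.symm
    rwa [div_eq_iff hd] at hstep
  set a' : ℕ → F := fun i => ((a i + a (k + 1 - i)) + m * (b i - b (k + 1 - i))) / 2 with ha'
  set b' : ℕ → F := fun i => a' i / m with hb'
  -- This is what the choice of `m` achieves: the candidate, defined for indices up to `k + 1`, fits
  -- into length `k + 1`.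
  have hlast : a' (k + 1) = 0 := by
    simp only [ha', Nat.sub_self]
    rw [show a (k + 1) + a 0 + m * (b (k + 1) - b 0) = 0 by linear_combination h0, zero_div]
  have key : (matP k m).mulVec (joinHalves (k + 1) (2 * k + 2) a' b') =
      (matQ k).mulVec (joinHalves (k + 2) (2 * k + 4) a b) := by
    funext r
    by_cases hr : (r : ℕ) < (k + 3) / 2
    · rw [matP_mulVec_plus k m a' b' hlast r hr, matQ_mulVec_plus k a b r hr]
      split_ifs with h
      · simp only [ha', show k + 1 - (r : ℕ) = r by omega]
        field_simp
        ring
      · simp only [ha', show k + 1 - (k + 1 - (r : ℕ)) = r by omega]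
        field_simp
        ring
    · by_cases hr' : (r : ℕ) < k + 2
      · rw [matP_mulVec_minus k m a' b' (by simp only [hb', hlast, zero_div]) r hr hr',
          matQ_mulVec_minus k a b r hr hr']
        set i := (r : ℕ) - (k + 3) / 2 with hi
        simp only [hb', ha', show k + 1 - (k + 1 - i) = i by omega]
        field_simp
        ring
      · rw [matP_mulVec_last k m a' b' r hr', matQ_mulVec_zero k _ r hr hr']
        simp only [hb']
        field_simp
        ring
  unfold stepV
  rw [hstep, ← key, Matrix.mulVec_mulVec, Matrix.nonsing_inv_mul _ hdet, Matrix.one_mulVec]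

end LinearAlgebra

/-! ### Schur–Cohn reduction for zeros in the closed unit disc. -/

section SchurCohn

/-- The real polynomial `f` has no complex zeros in the closed unit disc. -/
def ZeroFree (f : ℝ[X]) : Prop :=
  ∀ z : ℂ, ‖z‖ ≤ 1 → aeval z f ≠ 0

theorem aeval_reflect {f : ℝ[X]} {N : ℕ} (hf : f.natDegree ≤ N) {z : ℂ} (hz : z ≠ 0) :
    aeval z (reflect N f) = z ^ N * aeval z⁻¹ f := by
  let _ : Invertible z⁻¹ := invertibleOfNonzero (inv_ne_zero hz)
  have h := eval₂_reflect_mul_pow (algebraMap ℝ ℂ) z⁻¹ N f hf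
  rw [invOf_eq_inv, inv_inv, inv_pow] at h
  rw [aeval_def, aeval_def, ← h]
  field_simp

theorem norm_aeval_reflect {f : ℝ[X]} {N : ℕ} (hf : f.natDegree ≤ N) {z : ℂ} (hz : ‖z‖ = 1) :
    ‖aeval z (reflect N f)‖ = ‖aeval z f‖ := by
  have h0 : z ≠ 0 := by
    rintro rfl
    simp at hz
  rw [aeval_reflect hf h0, norm_mul, norm_pow, hz, one_pow, one_mul, Complex.inv_eq_conj hz,
    aeval_conj, Complex.norm_conj]

/-- Maximum modulus principle for the quotient of the reversal by `f`: it is holomorphic on the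
closed disc and has modulus `1` on the circle, since the coefficients are real. -/
theorem ZeroFree.norm_reflect_le {f : ℝ[X]} (h : ZeroFree f) {N : ℕ} (hf : f.natDegree ≤ N)
    {z : ℂ} (hz : ‖z‖ ≤ 1) : ‖aeval z (reflect N f)‖ ≤ ‖aeval z f‖ := by
  have hcl : closure (Metric.ball (0 : ℂ) 1) = Metric.closedBall 0 1 :=
    closure_ball _ one_ne_zero
  have hdiff : DiffContOnCl ℂ (fun w : ℂ => aeval w (reflect N f) / aeval w f)
      (Metric.ball 0 1) := by
    apply DifferentiableOn.diffContOnCl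
    rw [hcl]
    intro w hw
    apply DifferentiableAt.differentiableWithinAt
    exact (Polynomial.differentiable_aeval _ w).div (Polynomial.differentiable_aeval _ w)
      (h w (by simpa using hw))
  have hle := Complex.norm_le_of_forall_mem_frontier_norm_le Metric.isBounded_ball hdiff (C := 1)
    (z := z) ?_ ?_
  · rwa [norm_div, div_le_one (norm_pos_iff.mpr (h z hz))] at hle
  · intro w hw
    rw [frontier_ball _ one_ne_zero, mem_sphere_zero_iff_norm] at hw
    rw [norm_div, norm_aeval_reflect hf hw, div_self]
    exact norm_ne_zero_iff.mpr (h w hw.le)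
  · rw [hcl]
    simpa using hz

theorem ZeroFree.combination {f : ℝ[X]} (h : ZeroFree f) {N : ℕ} (hf : f.natDegree ≤ N)
    {α β : ℝ} (hαβ : |β| < |α|) : ZeroFree (C α * f + C β * reflect N f) := by
  intro z hz h0
  have hle := h.norm_reflect_le hf hz
  have hpos := norm_pos_iff.mpr (h z hz)
  simp only [map_add, map_mul, aeval_C, Complex.coe_algebraMap] at h0
  have e := congrArg norm (eq_neg_of_add_eq_zero_left h0)
  rw [norm_neg, norm_mul, norm_mul, Complex.norm_real, Complex.norm_real, Real.norm_eq_abs,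
    Real.norm_eq_abs] at e
  have h1 : |β| * ‖aeval z (reflect N f)‖ ≤ |β| * ‖aeval z f‖ :=
    mul_le_mul_of_nonneg_left hle (abs_nonneg _)
  have h2 := mul_lt_mul_of_pos_right hαβ hpos
  linarith

theorem zeroFree_C_mul {c : ℝ} (hc : c ≠ 0) (f : ℝ[X]) : ZeroFree (C c * f) ↔ ZeroFree f := by
  simp [ZeroFree, hc]

theorem reflect_reflect (N : ℕ) (f : ℝ[X]) : reflect N (reflect N f) = f := by
  ext i
  rw [coeff_reflect, coeff_reflect, revAt_invol]

theorem natDegree_reflect_le_of_le {f : ℝ[X]} {N : ℕ} (hf : f.natDegree ≤ N) :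
    (reflect N f).natDegree ≤ N := by
  rw [natDegree_le_iff_coeff_eq_zero]
  intro i hi
  rw [coeff_reflect, revAt_eq_self_of_lt hi]
  exact coeff_eq_zero_of_natDegree_lt (by omega)

/-- The Schur–Cohn reduction of a polynomial with respect to the formal degree `N`. -/
def schurStep (N : ℕ) (r : ℝ) (f : ℝ[X]) : ℝ[X] :=
  C ((1 + r) / 2) * f + C ((1 - r) / 2) * reflect N f

theorem abs_one_sub_div_lt {r : ℝ} (hr : 0 < r) : |(1 - r) / 2| < |(1 + r) / 2| := by
  rw [abs_of_pos (show 0 < (1 + r) / 2 by positivity), abs_lt]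
  constructor <;> linarith

theorem natDegree_schurStep_le' {f : ℝ[X]} {N : ℕ} (hf : f.natDegree ≤ N) (r : ℝ) :
    (schurStep N r f).natDegree ≤ N :=
  natDegree_add_le_of_degree_le ((natDegree_C_mul_le _ _).trans hf)
    ((natDegree_C_mul_le _ _).trans (natDegree_reflect_le_of_le hf))

theorem coeff_schurStep {N i : ℕ} (hi : i ≤ N) (r : ℝ) (f : ℝ[X]) :
    (schurStep N r f).coeff i =
      ((f.coeff i + f.coeff (N - i)) + r * (f.coeff i - f.coeff (N - i))) / 2 := by
  rw [schurStep, coeff_add, coeff_C_mul, coeff_C_mul, coeff_reflect, revAt_le hi]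
  ring

/-- The hypothesis on `r` says precisely that the coefficient of degree `k + 1` cancels. -/
theorem natDegree_schurStep_le {f : ℝ[X]} {k : ℕ} (hf : f.natDegree ≤ k + 1) {r : ℝ}
    (hr : f.coeff 0 + f.coeff (k + 1) = r * (f.coeff 0 - f.coeff (k + 1))) :
    (schurStep (k + 1) r f).natDegree ≤ k := by
  rw [natDegree_le_iff_coeff_eq_zero]
  intro i hi
  rcases Nat.lt_or_ge (k + 1) i with h | h
  · exact coeff_eq_zero_of_natDegree_lt ((natDegree_schurStep_le' hf r).trans_lt h)
  · obtain rfl : i = k + 1 := by omega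
    rw [coeff_schurStep le_rfl, Nat.sub_self]
    linear_combination hr / 2

/-- The reduction can be undone by a combination of the same kind, with the sign of the second
coefficient changed. The two together multiply `f` by $(\frac{1+r}{2})^2 - (\frac{1-r}{2})^2 = r$.
-/
theorem zeroFree_schurStep_iff {f : ℝ[X]} {N : ℕ} (hf : f.natDegree ≤ N) {r : ℝ} (hr : 0 < r) :
    ZeroFree (schurStep N r f) ↔ ZeroFree f := by
  refine ⟨fun h => ?_, fun h => h.combination hf (abs_one_sub_div_lt hr)⟩
  have h1 := h.combination (natDegree_schurStep_le' hf r) (α := (1 + r) / 2) (β := -((1 - r) / 2))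
    (by rw [abs_neg]; exact abs_one_sub_div_lt hr)
  rw [← zeroFree_C_mul hr.ne']
  convert h1 using 1
  rw [schurStep, reflect_add, reflect_C_mul, reflect_C_mul, reflect_reflect]
  have : r = ((1 + r) / 2) ^ 2 - ((1 - r) / 2) ^ 2 := by ring
  conv_lhs => rw [this]
  simp only [map_sub, map_pow, map_neg]
  ring

theorem one_le_prod_norm {s : Multiset ℂ} (hs : ∀ w ∈ s, 1 < ‖w‖) : 1 ≤ ‖s.prod‖ := by
  induction s using Multiset.induction_on with
  | empty => simp
  | cons a s ih =>
    rw [Multiset.prod_cons, norm_mul]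
    have h1 := hs a (Multiset.mem_cons_self a s)
    have h2 := ih fun w hw => hs w (Multiset.mem_cons_of_mem hw)
    nlinarith

theorem one_lt_prod_norm {s : Multiset ℂ} (h0 : s ≠ 0) (hs : ∀ w ∈ s, 1 < ‖w‖) :
    1 < ‖s.prod‖ := by
  obtain ⟨a, ha⟩ := Multiset.exists_mem_of_ne_zero h0
  obtain ⟨t, rfl⟩ := Multiset.exists_cons_of_mem ha
  rw [Multiset.prod_cons, norm_mul]
  have h1 := hs a ha
  have h2 := one_le_prod_norm fun w hw => hs w (Multiset.mem_cons_of_mem hw)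
  nlinarith

theorem ZeroFree.coeff_zero_ne_zero {f : ℝ[X]} (h : ZeroFree f) : f.coeff 0 ≠ 0 := by
  have := h 0 (by simp)
  rwa [← coeff_zero_eq_aeval_zero', Complex.coe_algebraMap, Complex.ofReal_ne_zero] at this

/-- By Vieta, when the degree is exactly `k + 1`, the ratio of the constant to the leading
coefficient is up to sign the product of the roots, all of modulus greater than `1`. -/
theorem ZeroFree.abs_coeff_lt {f : ℝ[X]} (h : ZeroFree f) {k : ℕ} (hf : f.natDegree ≤ k + 1) :
    |f.coeff (k + 1)| < |f.coeff 0| := by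
  have hf0 := h.coeff_zero_ne_zero
  rcases hf.lt_or_eq with hlt | heq
  · rw [coeff_eq_zero_of_natDegree_lt hlt, abs_zero]
    exact abs_pos.mpr hf0
  · have hne : f ≠ 0 := by
      rintro rfl
      simp at hf0
    set p := f.map (algebraMap ℝ ℂ) with hp
    have hsp : p.Splits := IsAlgClosed.splits p
    have hp0 : p ≠ 0 := (Polynomial.map_ne_zero_iff (algebraMap ℝ ℂ).injective).mpr hne
    have hdeg : p.natDegree = k + 1 := by rw [hp, natDegree_map, heq]
    have hc := hsp.coeff_zero_eq_leadingCoeff_mul_prod_roots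
    have hroots : p.roots ≠ 0 := by
      intro h0
      have := hsp.natDegree_eq_card_roots
      rw [h0, hdeg] at this
      simp at this
    have h1 : 1 < ‖p.roots.prod‖ := by
      refine one_lt_prod_norm hroots fun w hw => ?_
      by_contra hle
      refine h w (not_lt.mp hle) ?_
      have := (mem_roots hp0).mp hw
      rwa [IsRoot, hp, eval_map_algebraMap] at this
    have e := congrArg norm hc
    rw [norm_mul, norm_mul, norm_pow, norm_neg, norm_one, one_pow, one_mul, leadingCoeff, hdeg, hp,
      coeff_map, coeff_map, Complex.coe_algebraMap, Complex.norm_real, Complex.norm_real,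
      Real.norm_eq_abs, Real.norm_eq_abs] at e
    rw [e]
    have hl : 0 < |f.coeff (k + 1)| := by
      rw [abs_pos, ← heq]
      exact leadingCoeff_ne_zero.mpr hne
    exact lt_mul_of_one_lt_right hl h1

end SchurCohn

/-! ### Cohn's criterion for self-reciprocal polynomials. -/

section Cohn

variable {A : ℝ[X]} {N : ℕ}

/-- The reversed derivative `N A - x A'` of a self-reciprocal polynomial of degree `N`. -/
def reversedDerivative (N : ℕ) (A : ℝ[X]) : ℝ[X] :=
  C (N : ℝ) * A - X * derivative A

theorem coeff_reversedDerivative (N : ℕ) (A : ℝ[X]) (i : ℕ) :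
    (reversedDerivative N A).coeff i = ((N : ℝ) - i) * A.coeff i := by
  rw [reversedDerivative, coeff_sub, coeff_C_mul]
  cases i with
  | zero => simp
  | succ i =>
    rw [coeff_X_mul, coeff_derivative]
    push_cast
    ring

theorem natDegree_reversedDerivative_le (hA : A.natDegree ≤ N + 1) :
    (reversedDerivative (N + 1) A).natDegree ≤ N := by
  rw [natDegree_le_iff_coeff_eq_zero]
  intro i hi
  rw [coeff_reversedDerivative]
  rcases Nat.lt_or_ge (N + 1) i with h | h
  · rw [coeff_eq_zero_of_natDegree_lt (hA.trans_lt h), mul_zero]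
  · obtain rfl : i = N + 1 := by omega
    rw [sub_self, zero_mul]

theorem reflect_reversedDerivative (hA : A.natDegree ≤ N + 1) (hrec : reflect (N + 1) A = A) :
    reflect N (reversedDerivative (N + 1) A) = derivative A := by
  ext i
  rw [coeff_reflect, coeff_reversedDerivative, coeff_derivative]
  rcases Nat.lt_or_ge N i with h | h
  · rw [revAt_eq_self_of_lt h, coeff_eq_zero_of_natDegree_lt (show A.natDegree < i + 1 by omega)]
    rcases Nat.lt_or_ge (N + 1) i with h' | h'
    · rw [coeff_eq_zero_of_natDegree_lt (hA.trans_lt h')]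
      ring
    · obtain rfl : i = N + 1 := by omega
      ring
  · have e : A.coeff (N - i) = A.coeff (i + 1) := by
      conv_lhs => rw [← hrec]
      rw [coeff_reflect, revAt_le (by omega), show N + 1 - (N - i) = i + 1 by omega]
    rw [revAt_le h, e, Nat.cast_sub h]
    push_cast
    ring

theorem aeval_reversedDerivative (N : ℕ) (A : ℝ[X]) (z : ℂ) :
    aeval z (reversedDerivative N A) = N * aeval z A - z * aeval z (derivative A) := by
  simp [reversedDerivative]

/-- The Möbius map $z \mapsto w/(w-z) = 1/(1 - z/w)$ sends the closed disc without $w$ into the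
half-plane $\mathrm{Re} \ge 1/2$. -/
theorem re_div_sub_pos {w z : ℂ} (hw : ‖w‖ = 1) (hz : ‖z‖ ≤ 1) (hne : z ≠ w) :
    0 < (w / (w - z)).re := by
  have hw' : w.re ^ 2 + w.im ^ 2 = 1 := by
    have := Complex.sq_norm w
    rw [hw, Complex.normSq_apply] at this
    linarith
  have hz' : z.re ^ 2 + z.im ^ 2 ≤ 1 := by
    have := Complex.sq_norm z
    rw [Complex.normSq_apply] at this
    nlinarith [norm_nonneg z]
  have hpos : 0 < Complex.normSq (w - z) := Complex.normSq_pos.mpr (sub_ne_zero.mpr hne.symm)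
  rw [Complex.div_re, ← add_div]
  apply div_pos _ hpos
  rw [Complex.normSq_apply] at hpos
  simp only [Complex.sub_re, Complex.sub_im] at hpos ⊢
  nlinarith

theorem re_sum_pos {s : Multiset ℂ} (h0 : s ≠ 0) {φ : ℂ → ℂ} (h : ∀ w ∈ s, 0 < (φ w).re) :
    0 < ((s.map φ).sum).re := by
  have hnn : ∀ t : Multiset ℂ, (∀ w ∈ t, 0 < (φ w).re) → 0 ≤ ((t.map φ).sum).re := by
    intro t ht
    induction t using Multiset.induction_on with
    | empty => simp
    | cons a t ih =>
      rw [Multiset.map_cons, Multiset.sum_cons, Complex.add_re]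
      exact add_nonneg (ht a (Multiset.mem_cons_self a t)).le
        (ih fun w hw => ht w (Multiset.mem_cons_of_mem hw))
  obtain ⟨a, ha⟩ := Multiset.exists_mem_of_ne_zero h0
  obtain ⟨t, rfl⟩ := Multiset.exists_cons_of_mem ha
  rw [Multiset.map_cons, Multiset.sum_cons, Complex.add_re]
  exact add_pos_of_pos_of_nonneg (h a ha) (hnn t fun w hw => h w (Multiset.mem_cons_of_mem hw))

/-- The logarithmic derivative gives $(N+1) - zA'(z)/A(z) = \sum_w w/(w-z)$ over the roots $w$, and
every summand has positive real part. -/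
theorem aeval_reversedDerivative_ne_zero_of_ne (hN : A.natDegree = N + 1)
    (hroots : ∀ z : ℂ, aeval z A = 0 → ‖z‖ = 1) {z : ℂ} (hz : ‖z‖ ≤ 1) (hAz : aeval z A ≠ 0) :
    aeval z (reversedDerivative (N + 1) A) ≠ 0 := by
  set p := A.map (algebraMap ℝ ℂ) with hp
  have hsp : p.Splits := IsAlgClosed.splits p
  have hp0 : p ≠ 0 := by
    intro h
    apply hAz
    rw [← eval_map_algebraMap, ← hp, h, eval_zero]
  have hdeg : p.natDegree = N + 1 := by rw [hp, natDegree_map, hN]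
  have hcard : p.roots.card = N + 1 := by rw [← hsp.natDegree_eq_card_roots, hdeg]
  have hpz : p.eval z ≠ 0 := by rwa [hp, eval_map_algebraMap]
  have hne : ∀ w ∈ p.roots, w - z ≠ 0 := by
    intro w hw h
    obtain rfl := sub_eq_zero.mp h
    exact hpz ((mem_roots hp0).mp hw)
  have key := hsp.eval_derivative_div_eval_of_ne_zero hpz
  have hsum : aeval z (reversedDerivative (N + 1) A) / p.eval z =
      (p.roots.map fun w => w / (w - z)).sum := by
    have h1 : (p.roots.map fun w => w / (w - z)).sum =
        (p.roots.map fun w => 1 - z * (1 / (z - w))).sum := by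
      congr 1
      refine Multiset.map_congr rfl fun w hw => ?_
      have h1 := hne w hw
      have h2 : z - w ≠ 0 := by
        rw [← neg_sub]
        exact neg_ne_zero.mpr h1
      field_simp
      ring
    rw [h1, Multiset.sum_map_sub, Multiset.sum_map_mul_left, ← key, Multiset.map_const',
      Multiset.sum_replicate, hcard, aeval_reversedDerivative, hp, derivative_map,
      eval_map_algebraMap, eval_map_algebraMap, nsmul_eq_mul, mul_one]
    field_simp
  have hpos : 0 < ((p.roots.map fun w => w / (w - z)).sum).re := by
    apply re_sum_pos
    · intro h
      rw [h] at hcard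
      simp at hcard
    · intro w hw
      refine re_div_sub_pos (hroots w ?_) hz (sub_ne_zero.mp (hne w hw)).symm
      have := (mem_roots hp0).mp hw
      rwa [IsRoot, hp, eval_map_algebraMap] at this
  intro h0
  rw [← hsum, h0, zero_div] at hpos
  simp at hpos

/-- Cohn's criterion for simple zeros on the unit circle. -/
theorem zeroFree_reversedDerivative_iff (hA : A.natDegree ≤ N + 1)
    (hrec : reflect (N + 1) A = A) (h0 : A.coeff 0 ≠ 0) :
    ZeroFree (reversedDerivative (N + 1) A) ↔
      ∀ z : ℂ, aeval z A = 0 → ‖z‖ = 1 ∧ aeval z (derivative A) ≠ 0 := by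
  constructor
  · intro h
    -- At a zero of `A` the reversed derivative equals $-zA'(z)$, while its reflection is $A'(z)$.
    -- The bound on the reflection gives $|A'(z)| \le |z||A'(z)|$ with a nonzero right side,
    -- impossible for $|z| < 1$. Zeros outside the disc are then excluded by $z \mapsto 1/z$.
    have hlt : ∀ z : ℂ, ‖z‖ < 1 → aeval z A ≠ 0 := by
      intro z hz hAz
      have hle := h.norm_reflect_le (natDegree_reversedDerivative_le hA) hz.le
      have hpos := norm_pos_iff.mpr (h z hz.le)
      have e := aeval_reversedDerivative (N + 1) A z
      rw [hAz, mul_zero, zero_sub] at e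
      have e' := congrArg norm e
      rw [reflect_reversedDerivative hA hrec] at hle
      rw [norm_neg, norm_mul] at e'
      rw [e'] at hle hpos
      have h1 : 0 < ‖aeval z (derivative A)‖ := by
        by_contra hcon
        have : ‖aeval z (derivative A)‖ = 0 := le_antisymm (not_lt.mp hcon) (norm_nonneg _)
        rw [this, mul_zero] at hpos
        exact lt_irrefl _ hpos
      nlinarith
    intro z hAz
    have hz0 : z ≠ 0 := by
      rintro rfl
      exact hlt 0 (by simp) hAz
    have hz : ‖z‖ = 1 := by
      rcases lt_trichotomy ‖z‖ 1 with hz | hz | hz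
      · exact absurd hAz (hlt z hz)
      · exact hz
      · refine absurd ?_ (hlt z⁻¹ (by rw [norm_inv]; exact inv_lt_one_of_one_lt₀ hz))
        have := aeval_reflect hA hz0
        rw [hrec, hAz] at this
        exact (mul_eq_zero.mp this.symm).resolve_left (pow_ne_zero _ hz0)
    refine ⟨hz, fun hd => h z hz.le ?_⟩
    rw [aeval_reversedDerivative, hAz, hd, mul_zero, mul_zero, sub_zero]
  · intro h z hz
    have hdeg : A.natDegree = N + 1 := by
      refine le_antisymm hA (le_natDegree_of_ne_zero ?_)
      rw [← hrec, coeff_reflect, revAt_le le_rfl, Nat.sub_self]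
      exact h0
    by_cases hAz : aeval z A = 0
    · obtain ⟨hz1, hd⟩ := h z hAz
      have hz0 : z ≠ 0 := by
        rintro rfl
        simp at hz1
      rw [aeval_reversedDerivative, hAz, mul_zero, zero_sub]
      exact neg_ne_zero.mpr (mul_ne_zero hz0 hd)
    · exact aeval_reversedDerivative_ne_zero_of_ne hdeg (fun w hw => (h w hw).1) hz hAz

end Cohn

/-! ### Simple roots, and the coefficients of the given polynomial. -/

section RealPolynomial

theorem forall_isRoot_simple_iff {A : ℝ[X]} (hA : A ≠ 0) :
    (∀ z : ℂ, (A.map (algebraMap ℝ ℂ)).IsRoot z →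
      ‖z‖ = 1 ∧ (A.map (algebraMap ℝ ℂ)).rootMultiplicity z = 1) ↔
    ∀ z : ℂ, aeval z A = 0 → ‖z‖ = 1 ∧ aeval z (derivative A) ≠ 0 := by
  have hp0 : A.map (algebraMap ℝ ℂ) ≠ 0 :=
    (Polynomial.map_ne_zero_iff (algebraMap ℝ ℂ).injective).mpr hA
  refine forall_congr' fun z => ?_
  have h1 : (A.map (algebraMap ℝ ℂ)).IsRoot z ↔ aeval z A = 0 := by
    rw [IsRoot, eval_map_algebraMap]
  rw [h1]
  refine imp_congr_right fun hz => and_congr_right fun _ => ?_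
  have hpos := (rootMultiplicity_pos hp0).mpr (h1.mpr hz)
  have hmul := one_lt_rootMultiplicity_iff_isRoot (t := z) hp0
  rw [derivative_map, h1, IsRoot, eval_map_algebraMap] at hmul
  rw [Ne, ← not_iff_not.mpr (show 1 < (A.map (algebraMap ℝ ℂ)).rootMultiplicity z ↔
    aeval z (derivative A) = 0 by rw [hmul]; exact and_iff_right hz)]
  omega

theorem coeff_selfRecPoly (g : ℕ) (c : Fin (g + 1) → ℝ) {i : ℕ} (hi : i ≤ 2 * g) :
    (selfRecPoly g c).coeff i = c ⟨min i (2 * g - i), by omega⟩ := by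
  -- The default `0` is never reached, since `min j (2 * g - j) ≤ g`. The sum is split at the middle
  -- term and its upper part is read backwards to match the exponents `2 * g - k`.
  have hsum : selfRecPoly g c = ∑ j ∈ Finset.range (2 * g + 1),
      C (if h : min j (2 * g - j) < g + 1 then c ⟨min j (2 * g - j), h⟩ else 0) * X ^ j := by
    rw [show 2 * g + 1 = g + 1 + g by omega, Finset.sum_range_add, Finset.sum_range_succ,
      selfRecPoly]
    simp only [mul_add, Finset.sum_add_distrib]
    rw [← Fin.sum_univ_eq_sum_range (fun j => C (if h : min j (2 * g - j) < g + 1 then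
      c ⟨min j (2 * g - j), h⟩ else 0) * (X : ℝ[X]) ^ j) g, ← Finset.sum_range_reflect,
      ← Fin.sum_univ_eq_sum_range (fun j => C (if h : min (g + 1 + (g - 1 - j))
        (2 * g - (g + 1 + (g - 1 - j))) < g + 1 then
      c ⟨min (g + 1 + (g - 1 - j)) (2 * g - (g + 1 + (g - 1 - j))), h⟩ else 0) *
        (X : ℝ[X]) ^ (g + 1 + (g - 1 - j))) g]
    have e1 : ∀ k : Fin g, C (c k.castSucc) * (X : ℝ[X]) ^ (2 * g - (k : ℕ)) =
        C (if h : min (g + 1 + (g - 1 - (k : ℕ))) (2 * g - (g + 1 + (g - 1 - k))) < g + 1 then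
        c ⟨min (g + 1 + (g - 1 - k)) (2 * g - (g + 1 + (g - 1 - k))), h⟩ else 0) *
        (X : ℝ[X]) ^ (g + 1 + (g - 1 - (k : ℕ))) := by
      intro k
      have := k.2
      rw [dif_pos (by omega)]
      congr 3
      · ext
        simp
        omega
      · omega
    have e2 : ∀ k : Fin g, C (c k.castSucc) * (X : ℝ[X]) ^ (k : ℕ) =
        C (if h : min (k : ℕ) (2 * g - k) < g + 1 then
        c ⟨min k (2 * g - k), h⟩ else 0) * (X : ℝ[X]) ^ (k : ℕ) := by
      intro k
      have := k.2
      rw [dif_pos (by omega)]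
      congr 3
      ext
      simp
      omega
    have e3 : C (c (Fin.last g)) * (X : ℝ[X]) ^ g = C (if h : min g (2 * g - g) < g + 1 then
        c ⟨min g (2 * g - g), h⟩ else 0) * (X : ℝ[X]) ^ g := by
      rw [dif_pos (by omega)]
      congr 3
      ext
      simp
      omega
    rw [Finset.sum_congr rfl fun k _ => e1 k, Finset.sum_congr rfl fun k _ => e2 k, e3]
    ring
  rw [hsum, finsetSum_coeff, Finset.sum_eq_single i]
  · rw [coeff_C_mul, coeff_X_pow_self, mul_one, dif_pos]
  · intro j _ hj
    rw [coeff_C_mul, coeff_X_pow, if_neg (Ne.symm hj), mul_zero]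
  · intro h
    simp at h
    omega

theorem natDegree_selfRecPoly_le (g : ℕ) (c : Fin (g + 1) → ℝ) :
    (selfRecPoly g c).natDegree ≤ 2 * g := by
  refine natDegree_add_le_of_degree_le (natDegree_sum_le_of_forall_le _ _ fun k _ => ?_) ?_
  · refine (natDegree_C_mul_le _ _).trans (natDegree_add_le_of_degree_le ?_ ?_) <;>
    · rw [natDegree_X_pow]
      omega
  · refine (natDegree_C_mul_le _ _).trans ?_
    rw [natDegree_X_pow]
    omega

theorem reflect_selfRecPoly (g : ℕ) (c : Fin (g + 1) → ℝ) :
    reflect (2 * g) (selfRecPoly g c) = selfRecPoly g c := by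
  ext i
  rw [coeff_reflect]
  rcases Nat.lt_or_ge (2 * g) i with h | h
  · rw [revAt_eq_self_of_lt h]
  · rw [revAt_le h, coeff_selfRecPoly g c h, coeff_selfRecPoly g c (Nat.sub_le _ _)]
    congr 2
    omega

end RealPolynomial

/-! ### Values of rational functions, carried through one step. -/

section Values

variable {g : ℕ} {f f' : CoeffField g} {x : Option (Fin (g + 1)) → ℝ} {y y' : ℝ}

theorem algebraMap_ne_zero_of_aeval_ne_zero {p : MvPolynomial (Option (Fin (g + 1))) ℚ}
    (h : MvPolynomial.aeval x p ≠ 0) : algebraMap _ (CoeffField g) p ≠ 0 := by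
  intro h0
  have : p = 0 := IsFractionRing.injective (MvPolynomial (Option (Fin (g + 1))) ℚ)
    (CoeffField g) (by rw [h0, map_zero])
  rw [this, map_zero] at h
  exact h rfl

theorem hasValueAt_algebraMap (p : MvPolynomial (Option (Fin (g + 1))) ℚ)
    (x : Option (Fin (g + 1)) → ℝ) :
    HasValueAt (algebraMap _ (CoeffField g) p) x (MvPolynomial.aeval x p) :=
  ⟨p, 1, by simp, by simp, by simp⟩

theorem HasValueAt.add (h : HasValueAt f x y) (h' : HasValueAt f' x y') :
    HasValueAt (f + f') x (y + y') := by
  obtain ⟨a, b, hb, rfl, rfl⟩ := h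
  obtain ⟨a', b', hb', rfl, rfl⟩ := h'
  refine ⟨a * b' + b * a', b * b', by simp [hb, hb'], ?_, ?_⟩
  · rw [div_add_div _ _ (algebraMap_ne_zero_of_aeval_ne_zero hb)
      (algebraMap_ne_zero_of_aeval_ne_zero hb')]
    simp only [map_add, map_mul]
  · rw [div_add_div _ _ hb hb']
    simp only [map_add, map_mul]

theorem HasValueAt.neg (h : HasValueAt f x y) : HasValueAt (-f) x (-y) := by
  obtain ⟨a, b, hb, rfl, rfl⟩ := h
  exact ⟨-a, b, hb, by rw [map_neg, neg_div], by rw [map_neg, neg_div]⟩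

theorem HasValueAt.sub (h : HasValueAt f x y) (h' : HasValueAt f' x y') :
    HasValueAt (f - f') x (y - y') := by
  rw [sub_eq_add_neg, sub_eq_add_neg]
  exact h.add h'.neg

theorem HasValueAt.mul (h : HasValueAt f x y) (h' : HasValueAt f' x y') :
    HasValueAt (f * f') x (y * y') := by
  obtain ⟨a, b, hb, rfl, rfl⟩ := h
  obtain ⟨a', b', hb', rfl, rfl⟩ := h'
  refine ⟨a * a', b * b', by simp [hb, hb'], ?_, ?_⟩
  · rw [map_mul, map_mul, div_mul_div_comm]
  · rw [map_mul, map_mul, div_mul_div_comm]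

theorem HasValueAt.inv (h : HasValueAt f x y) (hy : y ≠ 0) : HasValueAt f⁻¹ x y⁻¹ := by
  obtain ⟨a, b, hb, rfl, rfl⟩ := h
  exact ⟨b, a, fun h0 => hy (by rw [h0, zero_div]), inv_div _ _, inv_div _ _⟩

theorem HasValueAt.div (h : HasValueAt f x y) (h' : HasValueAt f' x y') (hy' : y' ≠ 0) :
    HasValueAt (f / f') x (y / y') := by
  rw [div_eq_mul_inv, div_eq_mul_inv]
  exact h.mul (h'.inv hy')

theorem HasValueAt.ne_zero (h : HasValueAt f x y) (hy : y ≠ 0) : f ≠ 0 := by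
  rintro rfl
  refine hy (h.unique ?_)
  simpa using hasValueAt_algebraMap (0 : MvPolynomial (Option (Fin (g + 1))) ℚ) x

theorem hasValueAt_natCast (n : ℕ) : HasValueAt (n : CoeffField g) x n := by
  simpa using hasValueAt_algebraMap (n : MvPolynomial (Option (Fin (g + 1))) ℚ) x

theorem hasValueAt_two : HasValueAt (2 : CoeffField g) x 2 := by
  simpa using hasValueAt_natCast (g := g) (x := x) 2

theorem hasValueAt_indet (i : Option (Fin (g + 1))) : HasValueAt (indet g i) x (x i) := by
  simpa [indet] using hasValueAt_algebraMap (MvPolynomial.X i) x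

/-- The components of the vector `w` take the values `a 0, …, a (K - 1), b 0, b 1, …` at `x`. -/
def HasHalves {N : ℕ} (w : Fin N → CoeffField g) (K : ℕ) (x : Option (Fin (g + 1)) → ℝ)
    (a b : ℕ → ℝ) : Prop :=
  ∀ j : Fin N, HasValueAt (w j) x (if (j : ℕ) < K then a j else b (j - K))

/-- `f` and `f⁻¹` have positive values at `x`. -/
def PosValue (f : CoeffField g) (x : Option (Fin (g + 1)) → ℝ) : Prop :=
  (∃ y : ℝ, HasValueAt f x y ∧ 0 < y) ∧ (∃ y : ℝ, HasValueAt f⁻¹ x y ∧ 0 < y)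

theorem HasHalves.joinHalves_values {k N : ℕ} (hN : N = k + k)
    {u v : ℕ → CoeffField g} {a b : ℕ → ℝ} (h : HasHalves (joinHalves k N u v) k x a b)
    {i : ℕ} (hi : i < k) : HasValueAt (u i) x (a i) ∧ HasValueAt (v i) x (b i) := by
  have h1 := h ⟨i, by omega⟩
  have h2 := h ⟨k + i, by omega⟩
  simp only [joinHalves, if_pos hi] at h1
  simp only [joinHalves, Nat.not_lt.mpr (Nat.le_add_right k i), if_false,
    Nat.add_sub_cancel_left] at h2
  exact ⟨h1, h2⟩

variable {k : ℕ} {w : Fin (2 * k + 4) → CoeffField g} {a b : ℕ → ℝ}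

/-- The denominator of the quotient may vanish at `x`, so values are compared only after clearing
it. A nonzero value makes the quotient, hence its denominator, nonzero as a rational function. -/
theorem HasHalves.eq_mul_of_stepM (hw : HasHalves w (k + 2) x a b)
    (hm : HasValueAt (stepM k w) x y) (hy : y ≠ 0) :
    a 0 + a (k + 1) = y * (b 0 - b (k + 1)) := by
  obtain ⟨u, v, -, -, rfl⟩ := exists_eq_joinHalves (k + 2) (2 * k + 4) (by omega) w
  have hN : 2 * k + 4 = (k + 2) + (k + 2) := by omega
  have h0 := hw.joinHalves_values hN (i := 0) (by omega)
  have h1 := hw.joinHalves_values hN (i := k + 1) (by omega)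
  have hne := hm.ne_zero hy
  rw [stepM_joinHalves] at hm hne
  have hd := (div_ne_zero_iff.mp hne).2
  have hval := hm.mul (h0.2.sub h1.2)
  rw [div_mul_cancel₀ _ hd] at hval
  exact (h0.1.add h1.1).unique hval

theorem HasHalves.hasValueAt_stepM (hw : HasHalves w (k + 2) x a b)
    (hd : b 0 - b (k + 1) ≠ 0) :
    HasValueAt (stepM k w) x ((a 0 + a (k + 1)) / (b 0 - b (k + 1))) := by
  obtain ⟨u, v, -, -, rfl⟩ := exists_eq_joinHalves (k + 2) (2 * k + 4) (by omega) w
  have hN : 2 * k + 4 = (k + 2) + (k + 2) := by omega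
  have h0 := hw.joinHalves_values hN (i := 0) (by omega)
  have h1 := hw.joinHalves_values hN (i := k + 1) (by omega)
  rw [stepM_joinHalves]
  exact (h0.1.add h1.1).div (h0.2.sub h1.2) hd

theorem HasHalves.stepV (hw : HasHalves w (k + 2) x a b)
    (hm : HasValueAt (stepM k w) x y) (hy : y ≠ 0) :
    HasHalves (stepV k w) (k + 1) x
      (fun i => ((a i + a (k + 1 - i)) + y * (b i - b (k + 1 - i))) / 2)
      (fun i => ((a i + a (k + 1 - i)) + y * (b i - b (k + 1 - i))) / 2 / y) := by
  obtain ⟨u, v, -, -, rfl⟩ := exists_eq_joinHalves (k + 2) (2 * k + 4) (by omega) w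
  have hN : 2 * k + 4 = (k + 2) + (k + 2) := by omega
  rw [stepV_joinHalves (hasValueAt_two.ne_zero (x := x) two_ne_zero) k u v _ (hm.ne_zero hy) rfl]
  have hval : ∀ i < k + 1, HasValueAt
      (((u i + u (k + 1 - i)) + stepM k (joinHalves (k + 2) (2 * k + 4) u v) *
        (v i - v (k + 1 - i))) / 2) x
      (((a i + a (k + 1 - i)) + y * (b i - b (k + 1 - i))) / 2) := by
    intro i hi
    have h0 := hw.joinHalves_values hN (i := i) (by omega)
    have h1 := hw.joinHalves_values hN (i := k + 1 - i) (by omega)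
    exact ((h0.1.add h1.1).add (hm.mul (h0.2.sub h1.2))).div hasValueAt_two two_ne_zero
  intro j
  have := j.2
  unfold joinHalves
  split_ifs with hj
  · exact hval j hj
  · exact (hval (j - (k + 1)) (by omega)).div hm hy

theorem PosValue.of_hasValueAt (h : HasValueAt f x y) (hy : 0 < y) : PosValue f x :=
  ⟨⟨y, h, hy⟩, ⟨y⁻¹, h.inv hy.ne', inv_pos.mpr hy⟩⟩

theorem HasHalves.congr {N K : ℕ} {w : Fin N → CoeffField g} {a b a' b' : ℕ → ℝ}
    (h : HasHalves w K x a b) (hN : N = K + K) (ha : ∀ i < K, a i = a' i)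
    (hb : ∀ i < K, b i = b' i) : HasHalves w K x a' b' := by
  intro j
  have h1 := h j
  have := j.2
  split_ifs at h1 ⊢ with hj
  · rwa [← ha j hj]
  · rwa [← hb (j - K) (by omega)]

end Values

/-! ### The invariant along the iteration. -/

section Iteration

variable {g : ℕ} {c : Fin (g + 1) → ℝ} {q : ℝ}

/-- The initial vector over the field of rational functions. -/
def genericInit (g : ℕ) : Fin (2 * (2 * g) + 2) → CoeffField g :=
  initV g (fun k => indet g (some k)) (indet g none)

theorem hasHalves_genericInit (g : ℕ) (c : Fin (g + 1) → ℝ) (q : ℝ) :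
    HasHalves (genericInit g) (2 * g + 1) (evalPoint g c q) (selfRecPoly g c).coeff
      (fun i => (selfRecPoly g c).coeff i * (((g : ℝ) - i) * Real.log q)) := by
  intro j
  have := j.2
  unfold genericInit initV
  split_ifs with hj
  · rw [coeff_selfRecPoly g c (by omega)]
    exact hasValueAt_indet (some _)
  · beta_reduce
    rw [coeff_selfRecPoly g c (by omega)]
    exact (hasValueAt_indet (some _)).mul
      (((hasValueAt_natCast g).sub (hasValueAt_natCast _)).mul (hasValueAt_indet none))

/-- After `n` steps, the vector `v_g(n)` has as values the coefficients of a polynomial `f` of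
degree at most `2g - n` and their multiples by a constant, where `f` is free of zeros in the closed
unit disc if and only if the reversed derivative of the given polynomial is so. -/
def StepInvariant (c : Fin (g + 1) → ℝ) (q : ℝ) (n : ℕ) (h : n ≤ 2 * g) : Prop :=
  ∃ (f : ℝ[X]) (μ : ℝ), 0 < μ ∧ f.natDegree ≤ 2 * g - n ∧ f.coeff 0 ≠ 0 ∧
    HasHalves (sysV g (genericInit g) n h) (2 * g - n + 1) (evalPoint g c q) f.coeff
      (fun i => f.coeff i / μ) ∧
    (ZeroFree f ↔ ZeroFree (reversedDerivative (2 * g) (selfRecPoly g c)))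

theorem hasHalves_cast {n : ℕ} {h : n + 1 ≤ 2 * g} {h' : n ≤ 2 * g} {a b : ℕ → ℝ}
    {x : Option (Fin (g + 1)) → ℝ}
    (hs : HasHalves (sysV g (genericInit g) n h') (2 * g - n + 1) x a b) :
    HasHalves (fun j : Fin (2 * (2 * g - (n + 1)) + 4) =>
      sysV g (genericInit g) n h' (Fin.cast (by omega) j)) (2 * g - (n + 1) + 2) x a b := by
  intro j
  have h1 := hs (Fin.cast (by omega) j)
  rw [show 2 * g - n + 1 = 2 * g - (n + 1) + 2 by omega] at h1
  exact h1

theorem coeff_selfRecPoly_zero (g : ℕ) (c : Fin (g + 1) → ℝ) :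
    (selfRecPoly g c).coeff 0 = c 0 := by
  rw [coeff_selfRecPoly g c (Nat.zero_le _)]
  congr 1

theorem coeff_selfRecPoly_sub (g : ℕ) (c : Fin (g + 1) → ℝ) {i : ℕ} (hi : i ≤ 2 * g) :
    (selfRecPoly g c).coeff (2 * g - i) = (selfRecPoly g c).coeff i := by
  conv_rhs => rw [← reflect_selfRecPoly]
  rw [coeff_reflect, revAt_le hi]

/-- The first step is special because the initial halves are not proportional. It needs no
hypothesis on the zeros: its `m` always has the value $1/(g \log q) > 0$. -/
theorem stepInvariant_one (hg : 1 ≤ g) (hq : 1 < q) (hc : c 0 ≠ 0) :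
    StepInvariant c q 1 (by omega) ∧
      PosValue (sysM g (genericInit g) 1 le_rfl (by omega)) (evalPoint g c q) := by
  have hlog := Real.log_pos hq
  have hg' : (0 : ℝ) < g := by exact_mod_cast hg
  set A := selfRecPoly g c with hA
  have hA0 : A.coeff 0 = c 0 := coeff_selfRecPoly_zero g c
  have hAlast : A.coeff (2 * g) = c 0 := by
    have := coeff_selfRecPoly_sub g c (Nat.zero_le (2 * g))
    rwa [Nat.sub_zero, ← hA, hA0] at this
  have hk : 2 * g - (0 + 1) + 1 = 2 * g := by omega
  have hw := hasHalves_cast (n := 0) (h := by omega) (h' := by omega)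
    (hasHalves_genericInit g c q)
  have hμ : 0 < 1 / ((g : ℝ) * Real.log q) := by positivity
  have hm := hw.hasValueAt_stepM (by
    rw [hk, ← hA, hA0, hAlast]
    push_cast
    rw [show c 0 * (((g : ℝ) - 0) * Real.log q) - c 0 * (((g : ℝ) - 2 * g) * Real.log q) =
      2 * c 0 * (g * Real.log q) by ring]
    exact mul_ne_zero (mul_ne_zero two_ne_zero hc) (by positivity))
  have hval : (A.coeff 0 + A.coeff (2 * g - (0 + 1) + 1)) /
      (A.coeff 0 * (((g : ℝ) - (0 : ℕ)) * Real.log q) - A.coeff (2 * g - (0 + 1) + 1) *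
        (((g : ℝ) - (2 * g - (0 + 1) + 1 : ℕ)) * Real.log q)) = 1 / ((g : ℝ) * Real.log q) := by
    rw [hk, hA0, hAlast]
    push_cast
    have hd : c 0 * (((g : ℝ) - 0) * Real.log q) - c 0 * (((g : ℝ) - 2 * g) * Real.log q) =
      2 * c 0 * (g * Real.log q) := by ring
    rw [hd]
    field_simp
    norm_num
  rw [← hA, hval] at hm
  -- By symmetry of the coefficients $A_i$ of `A`, the new first half is $A_i(1 + (g-i)/g) =
  -- (2g-i)A_i/g$.
  refine ⟨⟨C (1 / (g : ℝ)) * reversedDerivative (2 * g) A, _, hμ, ?_, ?_, ?_, ?_⟩,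
    PosValue.of_hasValueAt hm hμ⟩
  · refine (natDegree_C_mul_le _ _).trans ?_
    have hdeg := natDegree_selfRecPoly_le g c
    have h1 : 2 * g = (2 * g - 1) + 1 := by omega
    have := natDegree_reversedDerivative_le (A := A) (N := 2 * g - 1) (by rw [← h1]; exact hdeg)
    rwa [← h1] at this
  · rw [coeff_C_mul, coeff_reversedDerivative, hA0]
    push_cast
    rw [sub_zero]
    positivity
  · have hstep := hw.stepV hm hμ.ne'
    have hcoeff : ∀ i < 2 * g - 1 + 1,
        ((A.coeff i + A.coeff (2 * g - (0 + 1) + 1 - i)) + 1 / ((g : ℝ) * Real.log q) *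
        (A.coeff i * (((g : ℝ) - i) * Real.log q) - A.coeff (2 * g - (0 + 1) + 1 - i) *
          (((g : ℝ) - (2 * g - (0 + 1) + 1 - i : ℕ)) * Real.log q))) / 2 =
        (C (1 / (g : ℝ)) * reversedDerivative (2 * g) A).coeff i := by
      intro i hi
      have hi' : i ≤ 2 * g := by omega
      rw [hk, coeff_C_mul, coeff_reversedDerivative, coeff_selfRecPoly_sub g c hi', ← hA,
        Nat.cast_sub hi']
      push_cast
      field_simp
      ring
    exact hstep.congr (by omega) hcoeff fun i hi => by
      rw [← hcoeff i hi]
  · exact zeroFree_C_mul (by positivity) _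

/-- Multiplying by $u - v$ gives $u^2 - v^2 = r(u-v)^2 > 0$. -/
theorem abs_lt_of_add_eq_mul_sub {u v r : ℝ} (hu : u ≠ 0) (hr : 0 < r)
    (h : u + v = r * (u - v)) : |v| < |u| := by
  have hne : u - v ≠ 0 := by
    intro h0
    rw [h0, mul_zero] at h
    exact hu (by linarith)
  have hpos : 0 < (u - v) ^ 2 := by positivity
  have h2 : u ^ 2 - v ^ 2 = r * (u - v) ^ 2 := by linear_combination (u - v) * h
  apply sq_lt_sq.mp
  nlinarith [mul_pos hr hpos]

theorem div_pos_of_abs_lt {u v : ℝ} (h : |v| < |u|) : 0 < (u + v) / (u - v) := by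
  have h2 := sq_lt_sq.mpr h
  have h3 : 0 < (u + v) * (u - v) := by nlinarith
  rcases pos_and_pos_or_neg_and_neg_of_mul_pos h3 with ⟨h4, h5⟩ | ⟨h4, h5⟩
  · exact div_pos h4 h5
  · exact div_pos_of_neg_of_neg h4 h5

/-- The disjunction serves both directions of the theorem: either alternative yields $|f_{k+1}| <
|f_0|$, and the rest of the step depends on nothing else. -/
theorem StepInvariant.succ {n : ℕ} {h : n ≤ 2 * g} (hI : StepInvariant c q n h)
    (h' : n + 1 ≤ 2 * g)
    (hor : PosValue (sysM g (genericInit g) (n + 1) (by omega) h') (evalPoint g c q) ∨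
      ZeroFree (reversedDerivative (2 * g) (selfRecPoly g c))) :
    StepInvariant c q (n + 1) h' ∧
      PosValue (sysM g (genericInit g) (n + 1) (by omega) h') (evalPoint g c q) := by
  obtain ⟨f, μ, hμ, hdeg, hf0, hs, hiff⟩ := hI
  have hw := hasHalves_cast (h := h') hs
  set k := 2 * g - (n + 1) with hk
  have hk1 : 2 * g - n = k + 1 := by omega
  rw [hk1] at hdeg
  have habs : |f.coeff (k + 1)| < |f.coeff 0| := by
    rcases hor with ⟨⟨y, hy, hypos⟩, -⟩ | hz
    · have e := hw.eq_mul_of_stepM hy hypos.ne'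
      refine abs_lt_of_add_eq_mul_sub hf0 (div_pos hypos hμ) ?_
      rw [e]
      ring
    · exact (hiff.mpr hz).abs_coeff_lt hdeg
  have hr := div_pos_of_abs_lt habs
  set r := (f.coeff 0 + f.coeff (k + 1)) / (f.coeff 0 - f.coeff (k + 1)) with hrdef
  have hd : f.coeff 0 - f.coeff (k + 1) ≠ 0 := by
    intro h0
    rw [hrdef, h0, div_zero] at hr
    exact lt_irrefl _ hr
  have hre : f.coeff 0 + f.coeff (k + 1) = r * (f.coeff 0 - f.coeff (k + 1)) := by
    rw [hrdef, div_mul_cancel₀ _ hd]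
  have hm := hw.hasValueAt_stepM (by
    rw [← sub_div]
    exact div_ne_zero hd hμ.ne')
  have hval : (f.coeff 0 + f.coeff (k + 1)) / (f.coeff 0 / μ - f.coeff (k + 1) / μ) = μ * r := by
    rw [← sub_div, hrdef]
    field_simp
  rw [hval] at hm
  have hμr : 0 < μ * r := mul_pos hμ hr
  refine ⟨⟨schurStep (k + 1) r f, μ * r, hμr, natDegree_schurStep_le hdeg hre, ?_, ?_,
    (zeroFree_schurStep_iff hdeg hr).trans hiff⟩, PosValue.of_hasValueAt hm hμr⟩
  -- The new constant coefficient is $f_0 + f_{k+1}$, the numerator of `r`, hence nonzero.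
  · rw [coeff_schurStep (Nat.zero_le _), Nat.sub_zero, ← hre]
    intro h0
    have hS : f.coeff 0 + f.coeff (k + 1) = 0 := by linarith
    rw [hrdef, hS, zero_div] at hr
    exact lt_irrefl _ hr
  · have hstep := hw.stepV hm hμr.ne'
    have hcoeff : ∀ i < k + 1,
        ((f.coeff i + f.coeff (k + 1 - i)) + μ * r *
          (f.coeff i / μ - f.coeff (k + 1 - i) / μ)) / 2 =
        (schurStep (k + 1) r f).coeff i := by
      intro i hi
      rw [coeff_schurStep hi.le]
      field_simp
    exact hstep.congr (by omega) hcoeff fun i hi => by rw [← hcoeff i hi]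

end Iteration

end SelfReciprocal

end

theorem theorem1 (g : ℕ) (hg : 1 ≤ g) (q : ℝ) (hq : 1 < q)
    (c : Fin (g + 1) → ℝ) (hc : c 0 ≠ 0) :
    (∀ z : ℂ, ((SelfReciprocal.selfRecPoly g c).map (algebraMap ℝ ℂ)).IsRoot z →
        ‖z‖ = 1 ∧
        ((SelfReciprocal.selfRecPoly g c).map (algebraMap ℝ ℂ)).rootMultiplicity z = 1) ↔
      ∀ (n : ℕ) (h₁ : 1 ≤ n) (h₂ : n ≤ 2 * g),
        (∃ y : ℝ, SelfReciprocal.HasValueAt (SelfReciprocal.ratM g n h₁ h₂)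
          (SelfReciprocal.evalPoint g c q) y ∧ 0 < y) ∧
        (∃ y : ℝ, SelfReciprocal.HasValueAt (SelfReciprocal.ratM g n h₁ h₂)⁻¹
          (SelfReciprocal.evalPoint g c q) y ∧ 0 < y) := by
  open SelfReciprocal in
  have hA0 : (selfRecPoly g c).coeff 0 ≠ 0 := by rwa [coeff_selfRecPoly_zero]
  have hA : selfRecPoly g c ≠ 0 := fun h => hA0 (by rw [h, Polynomial.coeff_zero])
  obtain ⟨N, hN⟩ : ∃ N, 2 * g = N + 1 := ⟨2 * g - 1, by omega⟩
  have hcohn := zeroFree_reversedDerivative_iff (hN ▸ natDegree_selfRecPoly_le g c)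
    (hN ▸ reflect_selfRecPoly g c) hA0
  rw [← hN] at hcohn
  rw [forall_isRoot_simple_iff hA, ← hcohn]
  constructor
  · intro hz n h₁ h₂
    have key : StepInvariant c q n h₂ ∧
        PosValue (sysM g (genericInit g) n h₁ h₂) (evalPoint g c q) := by
      induction n, h₁ using Nat.le_induction with
      | base => exact stepInvariant_one hg hq hc
      | succ n hn ih => exact (ih (by omega)).1.succ h₂ (Or.inr hz)
    exact key.2
  · intro hpos
    have key : ∀ (n : ℕ) (_ : 1 ≤ n) (h₂ : n ≤ 2 * g), StepInvariant c q n h₂ := by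
      intro n h₁ h₂
      induction n, h₁ using Nat.le_induction with
      | base => exact (stepInvariant_one hg hq hc).1
      | succ n hn ih => exact ((ih (by omega)).succ h₂ (Or.inl (hpos (n + 1) (by omega) h₂))).1
    -- After the last step the degree bound is `0`, so `f` is a nonzero constant and trivially
    -- zero-free.
    obtain ⟨f, μ, -, hdeg, hf0, -, hiff⟩ := key (2 * g) (by omega) le_rfl
    refine hiff.mp fun z _ => ?_
    rw [Polynomial.eq_C_of_natDegree_le_zero (hdeg.trans_eq (Nat.sub_self _)), Polynomial.aeval_C,
      Complex.coe_algebraMap, Complex.ofReal_ne_zero]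
    exact hf0
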